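/- Let $B$ be a quaternion algebra over $\mathbb{Q}$ ramified at $\infty$, and fix an isomorphism of $B\otimes_{\mathbb{Q}}\mathbb{R}$ with Hamilton's quaternions $\mathbb{R}\mathbf{1}\oplus\mathbb{R}\mathbf{i}\oplus\mathbb{R}\mathbf{j}\oplus\mathbb{R}\mathbf{k}$, $\mathbf i^2=\mathbf j^2=\mathbf k^2=\mathbf{ijk}=-1$. Let $B_0\subset B$ be a maximal order, and let $T$ be a positive definite half-integral symmetric $3\times 3$ matrix corresponding to $B_0$, i.e. such that $B_0$ is the even Clifford algebra of the integral ternary quadratic form $x\mapsto {}^t x\,T\,x$. Let $H_3(B_{\mathbb R})$ be the space of Hermitian matrices $$h=\begin{pmatrix} c_1 & a_3 & a_2^*\\ a_3^* & c_2 & a_1\\ a_2 & a_1^* & c_3\end{pmatrix},\qquad c_i\in\mathbb{R},\ a_i\in B\otimes\mathbb{R},$$ with trace $\mathrm{tr}(h)=c_1+c_2+c_3$ and norm $N(h)=c_1c_2c_3-c_1n(a_1)-c_2n(a_2)-c_3n(a_3)+\mathrm{tr}(a_1a_2a_3)$, where $n(a)=aa^*$ and $\mathrm{tr}(a)=a+a^*$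 for $a\in B\otimes\mathbb{R}$, and let $\Omega\subset H_3(B_{\mathbb R})$ be the cone of positive definite matrices. Let $dx$ be the Euclidean measure on $H_3(B_{\mathbb R})=\mathbb{R}^3\oplus (B\otimes\mathbb{R})^3$, i.e. the product of the Lebesgue measures in the $c_i$ and of the usual Euclidean measures on $\mathbb{R}\mathbf{1}\oplus\mathbb{R}\mathbf{i}\oplus\mathbb{R}\mathbf{j}\oplus\mathbb{R}\mathbf{k}$ in the $a_i$. Let $dY$ be the Haar measure on $H_3(B_{\mathbb R})$ that is the product of the Lebesgue measures in the $c_i$ and of the Haar measures on $B\otimes\mathbb{R}$ for which $B_0\backslash (B_0\otimes_{\mathbb Z}\mathbb{R})$ has volume $1$ in the $a_i$, and let $d^*Y=N(Y)^{-5}\,dY$ on $\Omega$. Then the constant relating the two invariant measures on $\Omega$ is $\det(T)^3$: $$N(x)^{-5}\,dx=\det(T)^3\,d^*Y .$$ Consequently the Siegel-type integral converges absolutely for all integers $r\ge 0$ and all $s\in\mathbb{C}$ with $\mathrm{Re}(s)+r-2>4$, and $$\det(T)^3\int_{\Omega}N(Y)^{s+r-2}e^{-2\pi\,\mathrm{tr}(Y)}\,d^*Y=\pi^{6}\,(2\pi)^{-3(s+r-2)}\,\Gamma(s+r-2)\,\Gamma(s+r-4)\,\Gamma(s+r-6).$$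 -/

import Mathlib

open scoped Quaternion TensorProduct
open MeasureTheory

noncomputable section

namespace QuatHerm

/-- Hamilton's quaternions `ℍ[ℝ]` carry their Borel structure. Together with the inner product
structure of Mathlib, for which `1, i, j, k` is an orthonormal basis, this makes `volume` on `ℍ[ℝ]`
the usual Euclidean measure on `ℝ 1 ⊕ ℝ i ⊕ ℝ j ⊕ ℝ k`. -/
instance instMeasurableSpaceQuaternion : MeasurableSpace ℍ[ℝ] := borel ℍ[ℝ]

instance instBorelSpaceQuaternion : BorelSpace ℍ[ℝ] := ⟨rfl⟩

section Arithmetic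

variable {B : Type*} [Ring B] [Algebra ℚ B]

/-- A subring is an order of the `ℚ`-algebra `B` if it is finitely generated as an abelian group and
spans `B` over `ℚ`. -/
structure IsOrder (O : Subring B) : Prop where
  fg : O.toAddSubgroup.FG
  span_eq_top : Submodule.span ℚ (O : Set B) = ⊤

/-- Maximal orders: maximal for inclusion among the orders of `B`. -/
def IsMaximalOrder (O : Subring B) : Prop := Maximal IsOrder O

/-- Half-integral symmetric `3 × 3` matrices: the matrices of the integral ternary quadratic forms
`x ↦ xᵗ T x`. -/
structure IsHalfIntegral (T : Matrix (Fin 3) (Fin 3) ℚ) : Prop where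
  symm : T.IsSymm
  diag : ∀ i, ∃ n : ℤ, T i i = n
  off_diag : ∀ i j, ∃ n : ℤ, 2 * T i j = n

/-- The half-integral matrix `T` corresponds to the quaternion order `O`: the order `O` is the even
Clifford algebra of the integral quadratic form `q (x) = xᵗ T x`. Writing `v₀, v₁, v₂` for the
standard basis of `ℤ³` and `⟨v, w⟩ = q (v + w) - q v - q w = 2 vᵗ T w`, the even Clifford algebra has
the `ℤ`-basis `1, e₀ = v₁ v₂, e₁ = v₂ v₀, e₂ = v₀ v₁`, and its multiplication is determined by the
relations below (the good basis of the ternary form). -/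
def Corresponds (T : Matrix (Fin 3) (Fin 3) ℚ) (O : Subring B) : Prop :=
  ∃ e₀ e₁ e₂ : B,
    LinearIndependent ℤ ![1, e₀, e₁, e₂] ∧
    AddSubgroup.closure {1, e₀, e₁, e₂} = O.toAddSubgroup ∧
    e₀ * e₀ = (2 * T 1 2) • e₀ - (T 1 1 * T 2 2) • (1 : B) ∧
    e₁ * e₁ = (2 * T 2 0) • e₁ - (T 2 2 * T 0 0) • (1 : B) ∧
    e₂ * e₂ = (2 * T 0 1) • e₂ - (T 0 0 * T 1 1) • (1 : B) ∧
    e₁ * e₂ = T 0 0 • ((2 * T 1 2) • (1 : B) - e₀) ∧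
    e₂ * e₀ = T 1 1 • ((2 * T 2 0) • (1 : B) - e₁) ∧
    e₀ * e₁ = T 2 2 • ((2 * T 0 1) • (1 : B) - e₂)

/-- The embedding `b ↦ φ (1 ⊗ b)` of `B` into its real points, which the isomorphism `φ` identifies
with Hamilton's quaternions. -/
def toReal (φ : ℝ ⊗[ℚ] B ≃ₐ[ℝ] ℍ[ℝ]) : B →+* ℍ[ℝ] :=
  (φ : ℝ ⊗[ℚ] B →+* ℍ[ℝ]).comp
    ((Algebra.TensorProduct.includeRight : B →ₐ[ℚ] ℝ ⊗[ℚ] B) : B →+* ℝ ⊗[ℚ] B)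

/-- The order `O` as a subgroup of the Euclidean space `ℍ[ℝ]`. -/
def orderLattice (φ : ℝ ⊗[ℚ] B ≃ₐ[ℝ] ℍ[ℝ]) (O : Subring B) : Submodule ℤ ℍ[ℝ] :=
  AddSubgroup.toIntSubmodule (O.map (toReal φ)).toAddSubgroup

end Arithmetic

/-- The space of `3 × 3` Hermitian matrices over `ℍ[ℝ]`, in the coordinates `h = (c, a)`, with
diagonal entries `c` and off-diagonal entries `a`. Its `volume` is the product of the Lebesgue
measures of the three real and the Euclidean measures of the three quaternionic coordinates. -/
abbrev Herm3 : Type := (Fin 3 → ℝ) × (Fin 3 → ℍ[ℝ])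

/-- The Hermitian matrix with coordinates `(c, a)`. -/
def toMatrix (h : Herm3) : Matrix (Fin 3) (Fin 3) ℍ[ℝ] :=
  !![(h.1 0 : ℍ[ℝ]), h.2 2, star (h.2 1);
     star (h.2 2), (h.1 1 : ℍ[ℝ]), h.2 0;
     h.2 1, star (h.2 0), (h.1 2 : ℍ[ℝ])]

/-- The (reduced) norm
`N h = c₁ c₂ c₃ - c₁ n (a₁) - c₂ n (a₂) - c₃ n (a₃) + tr (a₁ a₂ a₃)`, with `n a = a a*` and
`tr a = a + a*` on quaternions. -/
def norm (h : Herm3) : ℝ :=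
  h.1 0 * h.1 1 * h.1 2
    - h.1 0 * Quaternion.normSq (h.2 0)
    - h.1 1 * Quaternion.normSq (h.2 1)
    - h.1 2 * Quaternion.normSq (h.2 2)
    + (h.2 0 * h.2 1 * h.2 2 + star (h.2 0 * h.2 1 * h.2 2)).re

/-- The trace `c₁ + c₂ + c₃`. -/
def trace (h : Herm3) : ℝ := h.1 0 + h.1 1 + h.1 2

/-- The symmetric cone of positive definite Hermitian matrices: `x* h x > 0` for all `x ≠ 0` in
`ℍ[ℝ]³` (for Hermitian `h` the quaternion `x* h x` is real). -/
def posCone : Set Herm3 :=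
  {h | ∀ x : Fin 3 → ℍ[ℝ], x ≠ 0 → 0 < (star x ⬝ᵥ (toMatrix h).mulVec x).re}

/-- For a Haar measure `μ` on the space of Hermitian matrices, the measure `N (x)⁻⁵ dμ (x)` on the
cone of positive definite matrices. -/
def invariantMeasure (μ : Measure Herm3) : Measure Herm3 :=
  (μ.restrict posCone).withDensity fun x => ENNReal.ofReal (norm x ^ (-5 : ℤ))

/-- The Haar measure on `ℍ[ℝ]` for which the lattice `L` has covolume `1`. -/
def unitHaar (L : Submodule ℤ ℍ[ℝ]) : Measure ℍ[ℝ] :=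
  (ZLattice.covolume L volume).toNNReal⁻¹ • volume

/-- The Haar measure on the space of Hermitian matrices induced by the Haar measure on `ℍ[ℝ]` for
which `L` has covolume `1` (and by Lebesgue measure on `ℝ`, for which `ℤ` has covolume `1`). -/
def unitHaarHerm3 (L : Submodule ℤ ℍ[ℝ]) : Measure Herm3 :=
  (Measure.pi fun _ : Fin 3 => (volume : Measure ℝ)).prod
    (Measure.pi fun _ : Fin 3 => unitHaar L)

/-- The measure `N (x)⁻⁵ dx` on the cone, with `dx` the usual Euclidean measure. -/
def euclideanInvariantMeasure : Measure Herm3 := invariantMeasure volume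

/-- The measure `d* Y = N (Y)⁻⁵ dY` on the cone, with `dY` the Haar measure normalized by the order
`O`. -/
def dStar {B : Type*} [Ring B] [Algebra ℚ B] (φ : ℝ ⊗[ℚ] B ≃ₐ[ℝ] ℍ[ℝ]) (O : Subring B) :
    Measure Herm3 :=
  invariantMeasure (unitHaarHerm3 (orderLattice φ O))

/-- The integrand `N (Y) ^ w * exp (-2 π tr Y)` of the Siegel integral. -/
def siegelIntegrand (w : ℂ) (Y : Herm3) : ℂ :=
  (norm Y : ℂ) ^ w * (Real.exp (-2 * Real.pi * trace Y) : ℂ)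

end QuatHerm

end

/-! The measure comparison is a covolume computation. The good basis `1, e₀, e₁, e₂` is a `ℤ`-basis
of the order, so its covolume is the absolute value of the triple product of the imaginary parts of
the `eᵢ`. The Clifford relations fix traces, norms and products of the `eᵢ`, and these evaluate the
triple product to `-det T` (`tripleProduct_good_basis`, `covolume_orderLattice`). Three quaternionic
coordinates give `det (T) ^ 3`.

The integral is computed in the coordinates of `h = L D L*`. Passing to them is a composition of
shears, hence preserves Lebesgue measure (`measurePreserving_ldl`). The cone becomes positivity of
the three pivots (`mem_posCone_iff`), the norm their product (`norm_eq_of_ldl`), and the trace a sum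
in which the off-diagonal coordinates enter as `n (a) / pivot` (`trace_eq_of_ldl`). The integrand
thus splits into three Gamma integrals, of common exponent `w - 4`; Gaussian integration over 8, 4
and 0 real dimensions shifts it by 4, 2 and 0 (`siegelKernel_integral`). -/

noncomputable section

namespace QuatHerm

/-! ### The covolume of the order is `det T` -/

section Covolume

/-- The orthonormal basis `1, i, j, k` of `ℍ[ℝ]`. -/
def quaternionONB : OrthonormalBasis (Fin 4) ℝ ℍ[ℝ] :=
  OrthonormalBasis.ofRepr Quaternion.linearIsometryEquivTuple

lemma volumeReal_fundamentalDomain_eq_abs_det (b : Module.Basis (Fin 4) ℝ ℍ[ℝ]) :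
    volume.real (ZSpan.fundamentalDomain b) = |quaternionONB.toBasis.det b| := by
  rw [ZSpan.measureReal_fundamentalDomain b volume quaternionONB.toBasis,
    measureReal_congr (ZSpan.fundamentalDomain_ae_parallelepiped quaternionONB.toBasis volume),
    OrthonormalBasis.coe_toBasis, measureReal_def, OrthonormalBasis.volume_parallelepiped]
  simp

lemma quaternionONB_det_one_cons (x y z : ℍ[ℝ]) :
    quaternionONB.toBasis.det ![1, x, y, z] =
      x.imI * (y.imJ * z.imK - y.imK * z.imJ) - x.imJ * (y.imI * z.imK - y.imK * z.imI)
        + x.imK * (y.imI * z.imJ - y.imJ * z.imI) := by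
  have h : quaternionONB.toBasis.toMatrix ![1, x, y, z] =
      !![1, x.re, y.re, z.re; 0, x.imI, y.imI, z.imI; 0, x.imJ, y.imJ, z.imJ;
        0, x.imK, y.imK, z.imK] := by
    ext i j
    fin_cases i <;> fin_cases j <;>
      simp [Module.Basis.toMatrix_apply, quaternionONB]
  rw [Module.Basis.det_apply, h]
  simp [Matrix.det_succ_row_zero, Fin.sum_univ_succ, Fin.succAbove]
  ring

/-- A non-real quaternion satisfies only one monic real quadratic equation: the imaginary
coordinates of the relation say `(re x - t) * im x = 0`. -/
lemma re_eq_and_normSq_eq_of_mul_self {x : ℍ[ℝ]} {t n : ℝ}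
    (hx : ¬ ∃ r : ℝ, x = r) (h : x * x = (2 * t) • x - n • (1 : ℍ[ℝ])) :
    x.re = t ∧ Quaternion.normSq x = n := by
  have h0 := congrArg (fun q : ℍ[ℝ] => q.re) h
  have h1 := congrArg (fun q : ℍ[ℝ] => q.imI) h
  have h2 := congrArg (fun q : ℍ[ℝ] => q.imJ) h
  have h3 := congrArg (fun q : ℍ[ℝ] => q.imK) h
  simp at h0 h1 h2 h3
  have ht : x.re = t := by
    by_contra hne
    have hne' : x.re - t ≠ 0 := sub_ne_zero.2 hne
    refine hx ⟨x.re, ?_⟩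
    ext
    · simp
    · simpa using mul_left_cancel₀ hne' (by linarith : (x.re - t) * x.imI = (x.re - t) * 0)
    · simpa using mul_left_cancel₀ hne' (by linarith : (x.re - t) * x.imJ = (x.re - t) * 0)
    · simpa using mul_left_cancel₀ hne' (by linarith : (x.re - t) * x.imK = (x.re - t) * 0)
  refine ⟨ht, ?_⟩
  rw [Quaternion.normSq_def']
  subst ht
  linarith

/-- The triple product of the imaginary parts of a good basis is minus the determinant of the
ternary form. -/
lemma tripleProduct_good_basis {x y z : ℍ[ℝ]} {a b c u v w : ℝ}
    (hx : x.re = u) (hy : y.re = v) (hz : z.re = w)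
    (hxn : Quaternion.normSq x = b * c)
    (hyz : y * z = a • ((2 * u) • (1 : ℍ[ℝ]) - x))
    (hzx : z * x = b • ((2 * v) • (1 : ℍ[ℝ]) - y))
    (hxy : x * y = c • ((2 * w) • (1 : ℍ[ℝ]) - z)) :
    x.imI * (y.imJ * z.imK - y.imK * z.imJ) - x.imJ * (y.imI * z.imK - y.imK * z.imI)
        + x.imK * (y.imI * z.imJ - y.imJ * z.imI) =
      -(a * b * c + 2 * u * v * w - a * u ^ 2 - b * v ^ 2 - c * w ^ 2) := by
  have h1 := congrArg (fun q : ℍ[ℝ] => q.imI) hyz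
  have h2 := congrArg (fun q : ℍ[ℝ] => q.imJ) hyz
  have h3 := congrArg (fun q : ℍ[ℝ] => q.imK) hyz
  have h4 := congrArg (fun q : ℍ[ℝ] => q.re) hzx
  have h5 := congrArg (fun q : ℍ[ℝ] => q.re) hxy
  simp [hx, hy, hz] at h1 h2 h3 h4 h5
  rw [Quaternion.normSq_def', hx] at hxn
  -- Pairing `im (y z)` with `im x` gives the triple product plus `v (im x · im z) + w (im x · im
  -- y)`; the real parts of `z x` and `x y` supply these two inner products, and `normSq x` supplies
  -- `|im x|²`.
  linear_combination x.imI * h1 + x.imJ * h2 + x.imK * h3 - a * hxn + w * h5 + v * h4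

variable {B : Type*} [Ring B] [Algebra ℚ B] (φ : ℝ ⊗[ℚ] B ≃ₐ[ℝ] ℍ[ℝ])

lemma toReal_smul (q : ℚ) (x : B) : toReal φ (q • x) = (q : ℝ) • toReal φ x := by
  change φ (1 ⊗ₜ[ℚ] (q • x)) = (q : ℝ) • φ (1 ⊗ₜ[ℚ] x)
  rw [← map_smul, TensorProduct.tmul_smul, Rat.cast_smul_eq_qsmul]

lemma span_image_toReal_eq_top {S : Set B} (hS : Submodule.span ℚ S = ⊤) :
    Submodule.span ℝ (toReal φ '' S) = ⊤ := by
  have key (x : B) : toReal φ x ∈ Submodule.span ℝ (toReal φ '' S) := by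
    have hx : x ∈ Submodule.span ℚ S := hS ▸ Submodule.mem_top
    induction hx using Submodule.span_induction with
    | mem x hx => exact Submodule.subset_span ⟨x, hx, rfl⟩
    | zero => simp
    | add x y _ _ hx hy => rw [map_add]; exact add_mem hx hy
    | smul q x _ hx => rw [toReal_smul]; exact Submodule.smul_mem _ _ hx
  refine Submodule.eq_top_iff'.2 fun y => ?_
  obtain ⟨z, rfl⟩ := φ.surjective y
  induction z using TensorProduct.induction_on with
  | zero => simp
  | add x y hx hy => rw [map_add]; exact add_mem hx hy
  | tmul r x =>
    have : φ (r ⊗ₜ[ℚ] x) = r • toReal φ x := by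
      change _ = r • φ (1 ⊗ₜ[ℚ] x)
      rw [← map_smul, TensorProduct.smul_tmul', smul_eq_mul, mul_one]
    rw [this]
    exact Submodule.smul_mem _ _ (key x)

lemma orderLattice_eq_span {O : Subring B} {S : Set B}
    (hS : AddSubgroup.closure S = O.toAddSubgroup) :
    orderLattice φ O = Submodule.span ℤ (toReal φ '' S) := by
  apply Submodule.toAddSubgroup_injective
  rw [Submodule.span_int_eq_addSubgroupClosure]
  have h := AddMonoidHom.map_closure (toReal φ : B →+ ℍ[ℝ]) S
  rw [hS] at h
  exact h

/-- An order attached to the half-integral matrix `T` has covolume `det T` in `ℍ[ℝ]`. -/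
lemma covolume_orderLattice {O : Subring B} (hO : Submodule.span ℚ (O : Set B) = ⊤)
    {T : Matrix (Fin 3) (Fin 3) ℚ} (hsymm : T.IsSymm) (hdet : 0 < T.det)
    (hT : Corresponds T O) :
    ZLattice.covolume (orderLattice φ O) volume = (T.det : ℝ) := by
  obtain ⟨e₀, e₁, e₂, -, hcl, h00, h11, h22, h12, h20, h01⟩ := hT
  have himg : toReal φ '' {1, e₀, e₁, e₂} =
      Set.range ![1, toReal φ e₀, toReal φ e₁, toReal φ e₂] := by
    rw [Matrix.range_cons, Matrix.range_cons, Matrix.range_cons, Matrix.range_cons,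
      Matrix.range_empty, Set.union_empty]
    simp only [Set.image_insert_eq, Set.image_singleton, map_one, Set.singleton_union]
  have hL := orderLattice_eq_span φ hcl
  have hspan : ⊤ ≤ Submodule.span ℝ (Set.range ![1, toReal φ e₀, toReal φ e₁, toReal φ e₂]) := by
    rw [← span_image_toReal_eq_top φ hO, Submodule.span_le]
    rintro _ ⟨x, hx, rfl⟩
    have hx' : toReal φ x ∈ orderLattice φ O := ⟨x, hx, rfl⟩
    rw [hL, himg] at hx'
    exact Submodule.span_subset_span ℤ ℝ _ hx'
  let b := basisOfTopLeSpanOfCardEqFinrank _ hspan (by simp [Quaternion.finrank_eq_four])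
  have hb : ⇑b = ![1, toReal φ e₀, toReal φ e₁, toReal φ e₂] :=
    coe_basisOfTopLeSpanOfCardEqFinrank _ _ _
  -- Independence from `b 0 = 1` makes the `eᵢ` non-real, so that their quadratic relations
  -- determine trace and norm.
  have hnr (i : Fin 4) (hi : i ≠ 0) : ¬ ∃ r : ℝ, b i = r := by
    rintro ⟨r, hr⟩
    have hr' : b i = r • b 0 := by
      rw [hr, hb]
      simp [← Quaternion.coe_one, ← Quaternion.coe_smul]
    have := congrArg (fun x => b.repr x i) hr'
    simp [hi.symm] at this
  have t10 : T 1 0 = T 0 1 := hsymm.apply 0 1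
  have t20 : T 2 0 = T 0 2 := hsymm.apply 0 2
  have t21 : T 2 1 = T 1 2 := hsymm.apply 1 2
  have g := fun {x y : B} (h : x = y) => congrArg (toReal φ) h
  have k00 := g h00
  have k11 := g h11
  have k22 := g h22
  have k12 := g h12
  have k20 := g h20
  have k01 := g h01
  simp only [map_mul, map_sub, toReal_smul, map_one, Rat.cast_mul, Rat.cast_ofNat]
    at k00 k11 k22 k12 k20 k01
  have m0 := re_eq_and_normSq_eq_of_mul_self (by simpa [hb] using hnr 1 (by decide)) k00
  have m1 := re_eq_and_normSq_eq_of_mul_self (by simpa [hb] using hnr 2 (by decide)) k11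
  have m2 := re_eq_and_normSq_eq_of_mul_self (by simpa [hb] using hnr 3 (by decide)) k22
  have htriple := tripleProduct_good_basis m0.1 m1.1 m2.1 m0.2 k12 k20 k01
  rw [hL, himg, ← hb, ZLattice.covolume_eq_measure_fundamentalDomain _ volume
    (ZSpan.isAddFundamentalDomain b volume), volumeReal_fundamentalDomain_eq_abs_det, hb,
    quaternionONB_det_one_cons, htriple]
  have hd : (T 0 0 : ℝ) * T 1 1 * T 2 2 + 2 * T 1 2 * T 2 0 * T 0 1 - T 0 0 * T 1 2 ^ 2
      - T 1 1 * T 2 0 ^ 2 - T 2 2 * T 0 1 ^ 2 = (T.det : ℝ) := by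
    rw [Matrix.det_fin_three, t10, t20, t21]
    push_cast
    ring
  rw [hd, abs_neg, abs_of_pos (by exact_mod_cast hdet)]

end Covolume

/-! ### Comparison of the two invariant measures -/

section Comparison

lemma unitHaarHerm3_eq_smul (L : Submodule ℤ ℍ[ℝ]) :
    unitHaarHerm3 L = ((ZLattice.covolume L volume).toNNReal⁻¹ ^ 3) • volume := by
  have h : (Measure.pi fun _ : Fin 3 => unitHaar L) =
      ((ZLattice.covolume L volume).toNNReal⁻¹ ^ 3) • volume := by
    have : SigmaFinite (unitHaar L) := by unfold unitHaar; infer_instance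
    refine Measure.pi_eq fun s _ => ?_
    rw [Measure.smul_apply, volume_pi_pi]
    simp only [unitHaar, Measure.smul_apply, Fin.prod_univ_three,
      ENNReal.smul_def, smul_eq_mul, ENNReal.coe_pow]
    ring
  rw [unitHaarHerm3, h, Measure.prod_smul_right]
  rfl

lemma invariantMeasure_smul (c : NNReal) (μ : Measure Herm3) :
    invariantMeasure (c • μ) = c • invariantMeasure μ := by
  rw [invariantMeasure, Measure.restrict_smul]
  exact withDensity_smul_measure (c : ENNReal) _

lemma euclideanInvariantMeasure_eq_smul {L : Submodule ℤ ℍ[ℝ]} {D : ℝ} (hD : 0 < D)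
    (hL : ZLattice.covolume L volume = D) :
    euclideanInvariantMeasure = ENNReal.ofReal (D ^ 3) • invariantMeasure (unitHaarHerm3 L) := by
  rw [unitHaarHerm3_eq_smul, hL, invariantMeasure_smul, euclideanInvariantMeasure,
    ENNReal.ofReal_pow hD.le]
  change _ = (((D.toNNReal : ENNReal) ^ 3) • _)
  rw [← ENNReal.coe_pow, ← ENNReal.smul_def, smul_smul, inv_pow,
    mul_inv_cancel₀ (by simpa using hD), one_smul]

end Comparison

/-! ### The `L D L*` coordinates: measure, norm, cone and trace -/

section LDL

lemma measurable_normSq : Measurable (Quaternion.normSq : ℍ[ℝ] → ℝ) :=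
  Quaternion.continuous_normSq.measurable

lemma measurable_star_quaternion : Measurable (star : ℍ[ℝ] → ℍ[ℝ]) :=
  continuous_star.measurable

/-- A shear translates each fibre, so invariance of the measure on `Y` suffices and no Jacobian is
needed. -/
lemma measurePreserving_sub_right_of_measurable {X Y : Type*} [MeasureSpace X] [MeasureSpace Y]
    [SFinite (volume : Measure X)] [SFinite (volume : Measure Y)] [AddGroup Y]
    [MeasurableAdd₂ Y] [MeasurableNeg Y] [(volume : Measure Y).IsAddRightInvariant]
    {g : X → Y} (hg : Measurable g) :
    MeasurePreserving (fun p : X × Y => (p.1, p.2 - g p.1)) volume volume := by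
  refine MeasurePreserving.skew_product (f := id) (g := fun x y => y - g x)
    (MeasurePreserving.id _) ?_ (.of_forall fun x => ?_)
  · simp only [sub_eq_add_neg]
    fun_prop
  · simpa [sub_eq_add_neg] using (measurePreserving_add_right (volume : Measure Y) (-g x)).map_eq

lemma volume_preserving_finThree (X : Type*) [MeasureSpace X] [SigmaFinite (volume : Measure X)] :
    MeasurePreserving (fun f : Fin 3 → X => (f 0, (f 1, f 2))) volume volume :=
  ((MeasurePreserving.id (volume : Measure X)).prod (volume_preserving_finTwoArrow X)).comp
    (volume_preserving_piFinSuccAbove (fun _ : Fin 3 => X) 0)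

/-- The domain of the coordinates of the `L D L*` decomposition. -/
abbrev LDLSpace : Type := ((ℝ × (ℍ[ℝ] × ℍ[ℝ])) × (ℝ × ℍ[ℝ])) × ℝ

/-- The coordinates of `Herm3`, ordered as the `L D L*` decomposition needs them. -/
def reorder (h : Herm3) : LDLSpace :=
  (((h.1 0, (h.2 1, h.2 2)), (h.1 1, h.2 0)), h.1 2)

lemma measurePreserving_prodProdProdComm (X Y Z W : Type*) [MeasureSpace X] [MeasureSpace Y]
    [MeasureSpace Z] [MeasureSpace W] [SFinite (volume : Measure X)] [SFinite (volume : Measure Y)]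
    [SFinite (volume : Measure Z)] [SFinite (volume : Measure W)] :
    MeasurePreserving (fun p : (X × Y) × (Z × W) => ((p.1.1, p.2.1), (p.1.2, p.2.2)))
      volume volume := by
  have e1 := volume_preserving_prodAssoc (α₁ := X) (β₁ := Y) (γ₁ := Z × W)
  have e2 : MeasurePreserving (fun p : Y × (Z × W) => (p.2.1, (p.1, p.2.2))) volume volume :=
    (volume_preserving_prodAssoc (α₁ := Z) (β₁ := Y) (γ₁ := W)).comp
      (((Measure.measurePreserving_swap (μ := (volume : Measure Y)) (ν := (volume : Measure Z))).prod
        (MeasurePreserving.id (volume : Measure W))).comp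
        ((volume_preserving_prodAssoc (α₁ := Y) (β₁ := Z) (γ₁ := W)).symm _))
  have e3 := ((MeasurePreserving.id (volume : Measure X)).prod e2).comp e1
  exact ((volume_preserving_prodAssoc (α₁ := X) (β₁ := Z) (γ₁ := Y × W)).symm _).comp e3

lemma measurePreserving_reorder : MeasurePreserving reorder volume volume := by
  have s1 : MeasurePreserving (fun p : (Fin 3 → ℝ) × (Fin 3 → ℍ[ℝ]) =>
      ((p.1 0, (p.1 1, p.1 2)), ((p.2 1, p.2 2), p.2 0))) volume volume :=
    (volume_preserving_finThree ℝ).prod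
      (Measure.measurePreserving_swap.comp (volume_preserving_finThree ℍ[ℝ]))
  have s2 := (measurePreserving_prodProdProdComm ℝ (ℝ × ℝ) (ℍ[ℝ] × ℍ[ℝ]) ℍ[ℝ]).comp s1
  have s3 : MeasurePreserving (fun p : (ℝ × ℝ) × ℍ[ℝ] => ((p.1.1, p.2), p.1.2)) volume volume :=
    ((volume_preserving_prodAssoc (α₁ := ℝ) (β₁ := ℍ[ℝ]) (γ₁ := ℝ)).symm _).comp
      (((MeasurePreserving.id (volume : Measure ℝ)).prod Measure.measurePreserving_swap).comp
        (volume_preserving_prodAssoc (α₁ := ℝ) (β₁ := ℝ) (γ₁ := ℍ[ℝ])))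
  have s4 := ((MeasurePreserving.id (volume : Measure (ℝ × (ℍ[ℝ] × ℍ[ℝ])))).prod s3).comp s2
  exact ((volume_preserving_prodAssoc (α₁ := ℝ × (ℍ[ℝ] × ℍ[ℝ])) (β₁ := ℝ × ℍ[ℝ])
    (γ₁ := ℝ)).symm _).comp s4

/-- The `L D L*` coordinates `((c₀, (a₁, a₂)), (d₁, b)), d₂` of a Hermitian matrix: the matrix is
`L D L*` with `D = diag (c₀, d₁, d₂)` and `L` lower unitriangular with entries `a₂* / c₀`,
`a₁ / c₀` and `b* / d₁`. -/
def ldl (h : Herm3) : LDLSpace :=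
  let c := h.1 0
  let d := h.1 1 - Quaternion.normSq (h.2 2) / c
  let b := h.2 0 - c⁻¹ • (star (h.2 2) * star (h.2 1))
  (((c, (h.2 1, h.2 2)), (d, b)),
    h.1 2 - (Quaternion.normSq (h.2 1) / c + Quaternion.normSq b / d))

/-- After reordering, `ldl` is two shears: `(c₁, a₀)` moves by a function of `(c₀, a₁, a₂)`, then
`c₂` by a function of all the rest. Since `x / 0 = 0`, both are defined on the whole space, without
restriction to the cone. -/
lemma measurePreserving_ldl : MeasurePreserving ldl volume volume := by
  have m1 := measurable_normSq
  have m2 := measurable_star_quaternion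
  have : (volume : Measure (ℝ × ℍ[ℝ])).IsAddRightInvariant := by
    rw [Measure.volume_eq_prod]
    infer_instance
  have s1 := measurePreserving_sub_right_of_measurable
    (X := ℝ × (ℍ[ℝ] × ℍ[ℝ])) (Y := ℝ × ℍ[ℝ])
    (g := fun p => (Quaternion.normSq p.2.2 / p.1, p.1⁻¹ • (star p.2.2 * star p.2.1)))
    (by fun_prop)
  have s2 := measurePreserving_sub_right_of_measurable
    (X := (ℝ × (ℍ[ℝ] × ℍ[ℝ])) × (ℝ × ℍ[ℝ])) (Y := ℝ)
    (g := fun p => Quaternion.normSq p.1.2.1 / p.1.1 + Quaternion.normSq p.2.2 / p.2.1)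
    (by fun_prop)
  exact (s2.comp (s1.prod (MeasurePreserving.id (volume : Measure ℝ)))).comp
    measurePreserving_reorder

lemma norm_eq_of_ldl (h : Herm3) (hc : (ldl h).1.1.1 ≠ 0) (hd : (ldl h).1.2.1 ≠ 0) :
    norm h = (ldl h).1.1.1 * (ldl h).1.2.1 * (ldl h).2 := by
  obtain ⟨c, a⟩ := h
  -- The cross term of `normSq b` is the source of `tr (a₁ a₂ a₃)` in the norm.
  have hb : Quaternion.normSq (ldl (c, a)).1.2.2 = Quaternion.normSq (a 0)
      - (c 0)⁻¹ * (2 * (a 0 * a 1 * a 2).re)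
      + (c 0)⁻¹ ^ 2 * (Quaternion.normSq (a 1) * Quaternion.normSq (a 2)) := by
    simp only [ldl, Quaternion.normSq_def']
    simp
    ring
  have hd' : (ldl (c, a)).2 = c 2 - (Quaternion.normSq (a 1) / c 0 +
    Quaternion.normSq (ldl (c, a)).1.2.2 / (ldl (c, a)).1.2.1) := rfl
  have hd1 : (ldl (c, a)).1.2.1 = c 1 - Quaternion.normSq (a 2) / c 0 := rfl
  have hc1 : (ldl (c, a)).1.1.1 = c 0 := rfl
  rw [hd', hb, mul_sub, mul_add, mul_assoc _ _ (_ / (ldl (c, a)).1.2.1), mul_div_cancel₀ _ hd,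
    hd1, hc1]
  rw [hc1] at hc
  simp only [norm, Quaternion.re_add, Quaternion.re_star]
  field_simp
  ring

lemma normSq_add_smul (u v : ℍ[ℝ]) (t : ℝ) :
    Quaternion.normSq (u + t • v) =
      Quaternion.normSq u + 2 * t * (star u * v).re + t ^ 2 * Quaternion.normSq v := by
  simp only [Quaternion.normSq_def']
  simp
  ring

lemma re_dotProduct_mulVec (h : Herm3) (x : Fin 3 → ℍ[ℝ]) :
    (star x ⬝ᵥ (toMatrix h).mulVec x).re =
      h.1 0 * Quaternion.normSq (x 0) + h.1 1 * Quaternion.normSq (x 1)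
        + h.1 2 * Quaternion.normSq (x 2)
        + 2 * (star (x 0) * (h.2 2 * x 1)).re + 2 * (star (x 0) * (star (h.2 1) * x 2)).re
        + 2 * (star (x 1) * (h.2 0 * x 2)).re := by
  simp only [Quaternion.normSq_def', toMatrix, Matrix.mulVec, dotProduct, Fin.sum_univ_three]
  simp
  ring

/-- The Hermitian form is a sum of squares in the `L D L*` coordinates. -/
lemma re_dotProduct_mulVec_eq (h : Herm3) (hc : (ldl h).1.1.1 ≠ 0) (x : Fin 3 → ℍ[ℝ])
    (hd : (ldl h).1.2.1 ≠ 0 ∨ x 2 = 0) :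
    (star x ⬝ᵥ (toMatrix h).mulVec x).re =
      (ldl h).1.1.1 * Quaternion.normSq (x 0 + (ldl h).1.1.1⁻¹ •
        ((ldl h).1.1.2.2 * x 1 + star (ldl h).1.1.2.1 * x 2))
      + (ldl h).1.2.1 * Quaternion.normSq (x 1 + (ldl h).1.2.1⁻¹ • ((ldl h).1.2.2 * x 2))
      + (ldl h).2 * Quaternion.normSq (x 2) := by
  obtain ⟨c, a⟩ := h
  set b := (ldl (c, a)).1.2.2 with hb
  set d := (ldl (c, a)).1.2.1 with hd'
  set e := (ldl (c, a)).2 with he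
  have hc' : c 0 ≠ 0 := hc
  have ha0 : a 0 = b + (c 0)⁻¹ • (star (a 2) * star (a 1)) := by simp [hb, ldl]
  have hc1 : c 1 = d + Quaternion.normSq (a 2) / c 0 := by simp [hd', ldl]
  have hc2 : c 2 = e + (Quaternion.normSq (a 1) / c 0 + Quaternion.normSq b / d) := by
    simp [he, hb, hd', ldl]
  have hv : Quaternion.normSq (a 2 * x 1 + star (a 1) * x 2) =
      Quaternion.normSq (a 2) * Quaternion.normSq (x 1)
        + Quaternion.normSq (a 1) * Quaternion.normSq (x 2)
        + 2 * (star (x 1) * (star (a 2) * star (a 1) * x 2)).re := by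
    have := normSq_add_smul (a 2 * x 1) (star (a 1) * x 2) 1
    rw [one_smul] at this
    rw [this]
    simp only [map_mul, Quaternion.normSq_star, star_mul, mul_assoc]
    ring
  have hbx : d * Quaternion.normSq (x 1 + d⁻¹ • (b * x 2)) = d * Quaternion.normSq (x 1)
      + 2 * (star (x 1) * (b * x 2)).re
      + Quaternion.normSq b / d * Quaternion.normSq (x 2) := by
    -- The case `x 2 = 0` makes the identity available while the second pivot is not yet known to be
    -- nonzero, as its positivity proof requires.
    rcases hd with hd | hx
    · rw [normSq_add_smul, map_mul]
      field_simp
    · simp [hx]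
  have h0 : (ldl (c, a)).1.1.1 = c 0 := rfl
  have h1 : (ldl (c, a)).1.1.2.1 = a 1 := rfl
  have h2 : (ldl (c, a)).1.1.2.2 = a 2 := rfl
  rw [re_dotProduct_mulVec, hbx, h0, h1, h2, normSq_add_smul, hv]
  simp only [ha0, hc1, hc2, add_mul, mul_add, smul_mul_assoc, mul_smul_comm, Quaternion.re_add,
    Quaternion.re_smul, smul_eq_mul]
  field_simp
  ring

/-- The test vectors come from back substitution: each one kills the other squares and isolates a
single pivot. -/
lemma mem_posCone_iff (h : Herm3) :
    h ∈ posCone ↔ 0 < (ldl h).1.1.1 ∧ 0 < (ldl h).1.2.1 ∧ 0 < (ldl h).2 := by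
  constructor
  · intro hpos
    have hc : 0 < (ldl h).1.1.1 := by
      have := hpos ![1, 0, 0] (by simp)
      rw [re_dotProduct_mulVec] at this
      simpa [ldl] using this
    have hd : 0 < (ldl h).1.2.1 := by
      have := hpos ![-((ldl h).1.1.1⁻¹ • (ldl h).1.1.2.2), 1, 0] (by simp)
      rw [re_dotProduct_mulVec_eq h hc.ne' _ (.inr (by simp))] at this
      simpa using this
    have he : 0 < (ldl h).2 := by
      let y : ℍ[ℝ] := -((ldl h).1.2.1⁻¹ • (ldl h).1.2.2)
      have := hpos ![-((ldl h).1.1.1⁻¹ • ((ldl h).1.1.2.2 * y + star (ldl h).1.1.2.1)), y, 1]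
        (by simp)
      rw [re_dotProduct_mulVec_eq h hc.ne' _ (.inl hd.ne')] at this
      simpa [y] using this
    exact ⟨hc, hd, he⟩
  · rintro ⟨hc, hd, he⟩ x hx
    rw [re_dotProduct_mulVec_eq h hc.ne' x (.inl hd.ne')]
    have n (q : ℍ[ℝ]) : 0 ≤ Quaternion.normSq q := Quaternion.normSq_nonneg
    have n' {q : ℍ[ℝ]} (hq : q ≠ 0) : 0 < Quaternion.normSq q :=
      (n q).lt_of_ne' (Quaternion.normSq_ne_zero.2 hq)
    by_cases h2 : x 2 = 0
    · by_cases h1 : x 1 = 0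
      · have h0 : x 0 ≠ 0 := fun h0 => hx (by ext1 i; fin_cases i <;> assumption)
        simpa [h1, h2] using mul_pos hc (n' h0)
      · have := mul_pos hd (n' h1)
        have := mul_nonneg hc.le (n (x 0 + (ldl h).1.1.1⁻¹ •
          ((ldl h).1.1.2.2 * x 1 + star (ldl h).1.1.2.1 * x 2)))
        simp only [h2, mul_zero, smul_zero, add_zero, map_zero] at this ⊢
        linarith
    · have := mul_pos he (n' h2)
      have := mul_nonneg hc.le (n (x 0 + (ldl h).1.1.1⁻¹ •
          ((ldl h).1.1.2.2 * x 1 + star (ldl h).1.1.2.1 * x 2)))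
      have := mul_nonneg hd.le (n (x 1 + (ldl h).1.2.1⁻¹ • ((ldl h).1.2.2 * x 2)))
      linarith

lemma measurableSet_posCone : MeasurableSet posCone := by
  have : posCone = ldl ⁻¹' {p | 0 < p.1.1.1 ∧ 0 < p.1.2.1 ∧ 0 < p.2} := by
    ext h
    exact mem_posCone_iff h
  rw [this]
  exact measurePreserving_ldl.measurable <|
    (measurableSet_lt measurable_const (by fun_prop : Measurable fun p : LDLSpace => p.1.1.1)).inter
    ((measurableSet_lt measurable_const
      (by fun_prop : Measurable fun p : LDLSpace => p.1.2.1)).inter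
    (measurableSet_lt measurable_const (by fun_prop : Measurable fun p : LDLSpace => p.2)))

lemma norm_pos_of_mem_posCone {h : Herm3} (hh : h ∈ posCone) : 0 < norm h := by
  obtain ⟨hc, hd, he⟩ := (mem_posCone_iff h).1 hh
  rw [norm_eq_of_ldl h hc.ne' hd.ne']
  positivity

lemma trace_eq_of_ldl (h : Herm3) :
    trace h = ((ldl h).1.1.1 + (Quaternion.normSq (ldl h).1.1.2.1
        + Quaternion.normSq (ldl h).1.1.2.2) / (ldl h).1.1.1)
      + ((ldl h).1.2.1 + Quaternion.normSq (ldl h).1.2.2 / (ldl h).1.2.1) + (ldl h).2 := by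
  simp only [trace, ldl]
  ring

lemma measurable_norm : Measurable norm := by
  have m1 := measurable_normSq
  have m2 := Quaternion.continuous_re.measurable
  have m3 := measurable_star_quaternion
  unfold norm
  fun_prop

end LDL

/-! ### The Siegel integral as a product of Gamma integrals -/

section SiegelIntegral

/-- The factor `t ^ (z - 1) * exp (-2 π t)` of the Gamma integral, extended by zero to `t ≤ 0`. -/
def gammaKernel (z : ℂ) (t : ℝ) : ℂ :=
  (Set.Ioi 0).indicator (fun t : ℝ => (t : ℂ) ^ (z - 1) * Real.exp (-2 * Real.pi * t)) t

lemma measurable_gammaKernel (z : ℂ) : Measurable (gammaKernel z) := by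
  refine Measurable.indicator ?_ measurableSet_Ioi
  fun_prop

lemma integrable_gammaKernel {z : ℂ} (hz : 0 < z.re) : Integrable (gammaKernel z) := by
  have hpi : (0 : ℝ) < 2 * Real.pi := by positivity
  have h := (integrable_indicator_iff measurableSet_Ioi).2 (Complex.GammaIntegral_convergent hz)
  have h2 := (h.comp_mul_left' hpi.ne').const_mul (((2 * Real.pi : ℝ) : ℂ) ^ (z - 1))⁻¹
  refine h2.congr (.of_forall fun t => ?_)
  by_cases ht : 0 < t
  · have : 0 < 2 * Real.pi * t := by positivity
    simp only [gammaKernel, Set.indicator, Set.mem_Ioi, ht, this, if_true]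
    rw [Complex.ofReal_mul (2 * Real.pi), Complex.mul_cpow_ofReal_nonneg hpi.le ht.le]
    have hne : ((2 * Real.pi : ℝ) : ℂ) ^ (z - 1) ≠ 0 := by
      simp [Complex.cpow_eq_zero_iff, Real.pi_ne_zero]
    field_simp
  · have : ¬ 0 < 2 * Real.pi * t := by
      rwa [mul_pos_iff_of_pos_left hpi]
    simp [gammaKernel, Set.indicator, ht, this]

lemma integral_gammaKernel {z : ℂ} (hz : 0 < z.re) :
    ∫ t, gammaKernel z t = (2 * Real.pi : ℂ) ^ (-z) * Complex.Gamma z := by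
  have hpi : (0 : ℝ) < 2 * Real.pi := by positivity
  have h := Complex.integral_cpow_mul_exp_neg_mul_Ioi hz hpi
  rw [one_div, Complex.inv_cpow, ← Complex.cpow_neg] at h
  · simp only [gammaKernel]
    rw [integral_indicator measurableSet_Ioi]
    push_cast at h ⊢
    rw [← h]
    simp only [neg_mul]
  · rw [Complex.arg_ofReal_of_nonneg hpi.le]
    exact Real.pi_pos.ne

/-- Integrating a Gamma kernel against a family of Gaussians shifts its exponent. -/
lemma gammaKernel_mul_gaussian {W : Type*} [MeasureSpace W] [SFinite (volume : Measure W)]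
    {Q : W → ℝ} (hQ : Measurable Q) (k : ℕ)
    (hint : ∀ t : ℝ, 0 < t → Integrable fun w => Real.exp (-2 * Real.pi * (Q w / t)))
    (hval : ∀ t : ℝ, 0 < t → ∫ w, Real.exp (-2 * Real.pi * (Q w / t)) = (t / 2) ^ k)
    {z : ℂ} (hz : 0 < (z + k).re) :
    Integrable (fun p : ℝ × W =>
        gammaKernel z p.1 * (Real.exp (-2 * Real.pi * (Q p.2 / p.1)) : ℂ)) ∧
      ∫ p : ℝ × W, gammaKernel z p.1 * (Real.exp (-2 * Real.pi * (Q p.2 / p.1)) : ℂ)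
        = (2 : ℂ)⁻¹ ^ k * ((2 * Real.pi : ℂ) ^ (-(z + k)) * Complex.Gamma (z + k)) := by
  have hmeas : AEStronglyMeasurable (fun p : ℝ × W =>
      gammaKernel z p.1 * (Real.exp (-2 * Real.pi * (Q p.2 / p.1)) : ℂ)) := by
    have := measurable_gammaKernel z
    exact (by fun_prop : Measurable _).aestronglyMeasurable
  have hshift (t : ℝ) (ht : 0 < t) :
      gammaKernel z t * (((t / 2) ^ k : ℝ) : ℂ) = (2 : ℂ)⁻¹ ^ k * gammaKernel (z + k) t := by
    have ht' : (t : ℂ) ≠ 0 := by exact_mod_cast ht.ne'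
    simp only [gammaKernel, Set.indicator, Set.mem_Ioi, ht, if_true]
    rw [show z + k - 1 = (z - 1) + k by ring, Complex.cpow_add _ _ ht', Complex.cpow_natCast]
    push_cast
    rw [div_pow, inv_pow]
    ring
  have hneg (z : ℂ) (t : ℝ) (ht : ¬ 0 < t) : gammaKernel z t = 0 := by
    simp [gammaKernel, Set.indicator, ht]
  have hinner (t : ℝ) :
      ∫ w, gammaKernel z t * (Real.exp (-2 * Real.pi * (Q w / t)) : ℂ)
        = (2 : ℂ)⁻¹ ^ k * gammaKernel (z + k) t := by
    by_cases ht : 0 < t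
    · rw [integral_const_mul, integral_complex_ofReal, hval t ht, hshift t ht]
    · simp [hneg _ t ht]
  have hI : Integrable (fun p : ℝ × W =>
      gammaKernel z p.1 * (Real.exp (-2 * Real.pi * (Q p.2 / p.1)) : ℂ)) := by
    refine (integrable_prod_iff hmeas).2 ⟨.of_forall fun t => ?_, ?_⟩
    · by_cases ht : 0 < t
      · exact ((hint t ht).ofReal (𝕜 := ℂ)).const_mul (gammaKernel z t)
      · simp [hneg _ t ht]
    -- In absolute value too, the inner integral is `2⁻ᵏ` times the kernel of exponent `z + k`, so
    -- only `Re (z + k) > 0` is needed.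
    · refine ((integrable_gammaKernel hz).norm.const_mul (‖(2 : ℂ)⁻¹ ^ k‖)).congr
        (.of_forall fun t => ?_)
      by_cases ht : 0 < t
      · simp only [norm_mul, Complex.norm_real, Real.norm_eq_abs, Real.abs_exp]
        rw [integral_const_mul, hval t ht, ← norm_mul, ← hshift t ht, norm_mul, Complex.norm_real,
          Real.norm_of_nonneg (by positivity)]
      · simp [hneg _ t ht]
  refine ⟨hI, ?_⟩
  rw [Measure.volume_eq_prod, integral_prod _ hI]
  simp only [hinner]
  rw [integral_const_mul, integral_gammaKernel hz]

lemma integral_gaussian_quaternion {t : ℝ} (ht : 0 < t) :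
    ∫ q : ℍ[ℝ], Real.exp (-2 * Real.pi * (Quaternion.normSq q / t)) = (t / 2) ^ 2 := by
  have h := GaussianFourier.integral_rexp_neg_mul_sq_norm (V := ℍ[ℝ])
    (b := 2 * Real.pi / t) (by positivity)
  have h2 : Real.pi / (2 * Real.pi / t) = t / 2 := by
    have := Real.pi_ne_zero
    field_simp
  rw [h2, Quaternion.finrank_eq_four, show ((4 : ℕ) : ℝ) / 2 = (2 : ℕ) by norm_num,
    Real.rpow_natCast] at h
  rw [← h]
  refine integral_congr_ae (.of_forall fun q => ?_)
  simp only [Quaternion.normSq_eq_norm_mul_self]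
  ring_nf

lemma integrable_gaussian_quaternion {t : ℝ} (ht : 0 < t) :
    Integrable fun q : ℍ[ℝ] => Real.exp (-2 * Real.pi * (Quaternion.normSq q / t)) := by
  -- The Bochner integral of a non-integrable function is `0`, so the nonzero value already computed
  -- forces integrability.
  refine (integrable_of_integral_eq_one ?_ : Integrable fun q : ℍ[ℝ] =>
    ((t / 2) ^ 2)⁻¹ * Real.exp (-2 * Real.pi * (Quaternion.normSq q / t))).const_mul
      ((t / 2) ^ 2) |>.congr (.of_forall fun q => ?_)
  · rw [integral_const_mul, integral_gaussian_quaternion ht, inv_mul_cancel₀ (by positivity)]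
  · exact mul_inv_cancel_left₀ (by positivity) _

lemma exp_add_normSq_div (t : ℝ) (p : ℍ[ℝ] × ℍ[ℝ]) :
    Real.exp (-2 * Real.pi * ((Quaternion.normSq p.1 + Quaternion.normSq p.2) / t)) =
      Real.exp (-2 * Real.pi * (Quaternion.normSq p.1 / t)) *
        Real.exp (-2 * Real.pi * (Quaternion.normSq p.2 / t)) := by
  rw [← Real.exp_add]
  ring_nf

/-- The integrand of the Siegel integral, as a function of the `L D L*` coordinates. -/
def siegelKernel (w : ℂ) (p : LDLSpace) : ℂ :=
  ((gammaKernel (w - 4) p.1.1.1 * (Real.exp (-2 * Real.pi *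
      ((Quaternion.normSq p.1.1.2.1 + Quaternion.normSq p.1.1.2.2) / p.1.1.1)) : ℂ)) *
    (gammaKernel (w - 4) p.1.2.1 *
      (Real.exp (-2 * Real.pi * (Quaternion.normSq p.1.2.2 / p.1.2.1)) : ℂ))) *
    gammaKernel (w - 4) p.2

lemma siegelKernel_integral {w : ℂ} (hw : 4 < w.re) :
    Integrable (siegelKernel w) ∧ ∫ p, siegelKernel w p =
      (Real.pi : ℂ) ^ 6 * (2 * Real.pi : ℂ) ^ (-3 * w)
        * Complex.Gamma w * Complex.Gamma (w - 2) * Complex.Gamma (w - 4) := by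
  have hn := measurable_normSq
  have h1 := gammaKernel_mul_gaussian (W := ℍ[ℝ] × ℍ[ℝ]) (z := w - 4)
    (Q := fun p => Quaternion.normSq p.1 + Quaternion.normSq p.2) (by fun_prop) 4
    (fun t ht => by
      simp only [exp_add_normSq_div]
      exact (integrable_gaussian_quaternion ht).mul_prod (integrable_gaussian_quaternion ht))
    (fun t ht => by
      simp only [exp_add_normSq_div]
      rw [Measure.volume_eq_prod, integral_prod_mul (μ := (volume : Measure ℍ[ℝ]))
        (ν := (volume : Measure ℍ[ℝ]))
        (fun q => Real.exp (-2 * Real.pi * (Quaternion.normSq q / t)))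
        (fun q => Real.exp (-2 * Real.pi * (Quaternion.normSq q / t))),
        integral_gaussian_quaternion ht]
      ring)
    (by simp; linarith)
  have h2 := gammaKernel_mul_gaussian (z := w - 4) measurable_normSq 2
    (fun t ht => integrable_gaussian_quaternion ht) (fun t ht => integral_gaussian_quaternion ht)
    (by simp; linarith)
  have hw4 : 0 < (w - 4).re := by simpa using hw
  refine ⟨(h1.1.mul_prod h2.1).mul_prod (integrable_gammaKernel hw4), ?_⟩
  have e1 := integral_prod_mul (μ := (volume : Measure (ℝ × (ℍ[ℝ] × ℍ[ℝ]))))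
    (ν := (volume : Measure (ℝ × ℍ[ℝ])))
    (fun p => gammaKernel (w - 4) p.1 * (Real.exp (-2 * Real.pi *
      ((Quaternion.normSq p.2.1 + Quaternion.normSq p.2.2) / p.1)) : ℂ))
    (fun p => gammaKernel (w - 4) p.1 *
      (Real.exp (-2 * Real.pi * (Quaternion.normSq p.2 / p.1)) : ℂ))
  rw [h1.2, h2.2] at e1
  have e2 := integral_prod_mul
    (μ := (volume : Measure ((ℝ × (ℍ[ℝ] × ℍ[ℝ])) × (ℝ × ℍ[ℝ]))))
    (ν := (volume : Measure ℝ))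
    (fun p => (gammaKernel (w - 4) p.1.1 * (Real.exp (-2 * Real.pi *
      ((Quaternion.normSq p.1.2.1 + Quaternion.normSq p.1.2.2) / p.1.1)) : ℂ)) *
      (gammaKernel (w - 4) p.2.1 *
      (Real.exp (-2 * Real.pi * (Quaternion.normSq p.2.2 / p.2.1)) : ℂ)))
    (gammaKernel (w - 4))
  refine e2.trans ?_
  rw [integral_gammaKernel hw4, Measure.volume_eq_prod, e1]
  have hne : (2 * Real.pi : ℂ) ≠ 0 := by simp [Real.pi_ne_zero]
  rw [show w - 4 + (4 : ℕ) = w by push_cast; ring, show w - 4 + (2 : ℕ) = w - 2 by push_cast; ring]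
  -- The surplus `(2π) ^ 6` meets the `2⁻⁶` from the Gaussians (`2⁻⁴` and `2⁻²`), leaving `π ^ 6`.
  have hexp : (2 * Real.pi : ℂ) ^ (-w) * (2 * Real.pi : ℂ) ^ (-(w - 2)) *
      (2 * Real.pi : ℂ) ^ (-(w - 4)) = (2 * Real.pi : ℂ) ^ (-3 * w) * (2 * Real.pi : ℂ) ^ 6 := by
    rw [← Complex.cpow_add _ _ hne, ← Complex.cpow_add _ _ hne, ← Complex.cpow_natCast,
      ← Complex.cpow_add _ _ hne]
    congr 1
    push_cast
    ring
  linear_combination (2 : ℂ)⁻¹ ^ 6 * Complex.Gamma w * Complex.Gamma (w - 2) *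
    Complex.Gamma (w - 4) * hexp

/-- The extension by zero in `gammaKernel` absorbs the indicator: outside the cone some pivot is `≤
0` and its factor vanishes. Inside, `N ^ (w - 5)` gives each pivot the exponent `(w - 4) - 1`. -/
lemma indicator_posCone_siegelIntegrand (w : ℂ) (h : Herm3) :
    posCone.indicator
      (fun h => (ENNReal.ofReal (norm h ^ (-5 : ℤ))).toReal • siegelIntegrand w h) h =
      siegelKernel w (ldl h) := by
  by_cases hh : h ∈ posCone
  · obtain ⟨hc, hd, he⟩ := (mem_posCone_iff h).1 hh
    have hn := norm_pos_of_mem_posCone hh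
    have hn' : (norm h : ℂ) ≠ 0 := by exact_mod_cast hn.ne'
    rw [Set.indicator_of_mem hh, ENNReal.toReal_ofReal (by positivity), siegelIntegrand,
      Complex.real_smul]
    have hpow : ((norm h ^ (-5 : ℤ) : ℝ) : ℂ) * (norm h : ℂ) ^ w = (norm h : ℂ) ^ (w - 4 - 1) := by
      rw [Complex.ofReal_zpow, ← Complex.cpow_intCast, ← Complex.cpow_add _ _ hn']
      congr 1
      push_cast
      ring
    rw [← mul_assoc, hpow, norm_eq_of_ldl h hc.ne' hd.ne', trace_eq_of_ldl h]
    simp only [siegelKernel, gammaKernel, Set.indicator, Set.mem_Ioi, hc, hd, he, if_true]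
    rw [Complex.ofReal_mul, Complex.mul_cpow_ofReal_nonneg (by positivity) he.le,
      Complex.ofReal_mul, Complex.mul_cpow_ofReal_nonneg hc.le hd.le]
    simp only [mul_add, Real.exp_add, Complex.ofReal_mul]
    ring
  · rw [Set.indicator_of_notMem hh]
    rw [mem_posCone_iff] at hh
    simp only [siegelKernel, gammaKernel, Set.indicator, Set.mem_Ioi]
    split_ifs <;> simp_all

lemma measurable_siegelKernel (w : ℂ) : Measurable (siegelKernel w) := by
  have := measurable_gammaKernel (w - 4)
  have := measurable_normSq
  unfold siegelKernel
  fun_prop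

/-- The Siegel integral with respect to the Euclidean invariant measure. -/
lemma siegel_integral_euclidean {w : ℂ} (hw : 4 < w.re) :
    Integrable (siegelIntegrand w) euclideanInvariantMeasure ∧
      ∫ Y, siegelIntegrand w Y ∂euclideanInvariantMeasure =
        (Real.pi : ℂ) ^ 6 * (2 * Real.pi : ℂ) ^ (-3 * w)
          * Complex.Gamma w * Complex.Gamma (w - 2) * Complex.Gamma (w - 4) := by
  have hm : Measurable fun x => ENNReal.ofReal (norm x ^ (-5 : ℤ)) := by
    have := measurable_norm
    fun_prop
  have hlt (μ : Measure Herm3) : ∀ᵐ x ∂μ, ENNReal.ofReal (norm x ^ (-5 : ℤ)) < ⊤ :=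
    .of_forall fun _ => ENNReal.ofReal_lt_top
  have hk := siegelKernel_integral hw
  have hK := (measurable_siegelKernel w).aestronglyMeasurable (μ := (volume : Measure LDLSpace))
  constructor
  · rw [euclideanInvariantMeasure, invariantMeasure,
      integrable_withDensity_iff_integrable_smul' hm (hlt _),
      ← IntegrableOn, ← integrable_indicator_iff measurableSet_posCone]
    simp only [funext (indicator_posCone_siegelIntegrand w)]
    exact (measurePreserving_ldl.integrable_comp hK).2 hk.1
  · rw [euclideanInvariantMeasure, invariantMeasure,
      integral_withDensity_eq_integral_toReal_smul hm (hlt _),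
      ← integral_indicator measurableSet_posCone]
    simp only [indicator_posCone_siegelIntegrand w]
    rw [← hk.2, ← measurePreserving_ldl.map_eq,
      integral_map measurePreserving_ldl.measurable.aemeasurable
        (by rwa [measurePreserving_ldl.map_eq])]

end SiegelIntegral

end QuatHerm

end

theorem lemma2p4 {B : Type*} [Ring B] [Algebra ℚ B] (φ : ℝ ⊗[ℚ] B ≃ₐ[ℝ] ℍ[ℝ])
    (B₀ : Subring B) (hB₀ : QuatHerm.IsMaximalOrder B₀)
    (T : Matrix (Fin 3) (Fin 3) ℚ) (hT : QuatHerm.IsHalfIntegral T)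
    (hTpos : (T.map (fun q : ℚ => (q : ℝ))).PosDef) (hTB₀ : QuatHerm.Corresponds T B₀) :
    QuatHerm.euclideanInvariantMeasure
        = ENNReal.ofReal ((T.det : ℝ) ^ 3) • QuatHerm.dStar φ B₀ ∧
    ∀ (r : ℕ) (s : ℂ), 4 < (s + r - 2).re →
      Integrable (QuatHerm.siegelIntegrand (s + r - 2)) (QuatHerm.dStar φ B₀) ∧
      (T.det : ℂ) ^ 3 * ∫ Y, QuatHerm.siegelIntegrand (s + r - 2) Y ∂(QuatHerm.dStar φ B₀)
        = (Real.pi : ℂ) ^ 6 * (2 * Real.pi : ℂ) ^ (-3 * (s + r - 2))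
            * Complex.Gamma (s + r - 2) * Complex.Gamma (s + r - 4)
            * Complex.Gamma (s + r - 6) := by
  have hdetR : (0 : ℝ) < (T.det : ℝ) := by
    have h := hTpos.det_pos
    rwa [show (T.map fun q : ℚ => (q : ℝ)) = (Rat.castHom ℝ).mapMatrix T from rfl,
      ← RingHom.map_det] at h
  have hcov := QuatHerm.covolume_orderLattice φ hB₀.prop.span_eq_top hT.symm
    (by exact_mod_cast hdetR) hTB₀
  have hmeas : QuatHerm.euclideanInvariantMeasure
      = ENNReal.ofReal ((T.det : ℝ) ^ 3) • QuatHerm.dStar φ B₀ :=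
    QuatHerm.euclideanInvariantMeasure_eq_smul hdetR hcov
  refine ⟨hmeas, fun r s hs => ?_⟩
  obtain ⟨hI, hv⟩ := QuatHerm.siegel_integral_euclidean hs
  rw [hmeas] at hI hv
  -- The factor `det (T) ^ 3` is neither `0` nor `∞`, so integrability passes between the two
  -- measures.
  refine ⟨(integrable_smul_measure (by rw [Ne, ENNReal.ofReal_eq_zero, not_le]; positivity)
    ENNReal.ofReal_ne_top).1 hI, ?_⟩
  rw [integral_smul_measure, ENNReal.toReal_ofReal (by positivity), Complex.real_smul] at hv
  rw [show s + r - 4 = s + r - 2 - 2 by ring, show s + r - 6 = s + r - 2 - 4 by ring, ← hv, Complex.ofReal_pow,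
    Complex.ofReal_ratCast]
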